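/- **Model.** A line network of $L\ge 1$ links has nodes $v_0,\dots,v_L$ in tandem. The source $v_0$ holds a message of $k$ vectors over $\mathbb F_2$, which the sink $v_L$ wants. In every time unit $t=1,2,\dots$ each of $v_0,\dots,v_{L-1}$ sends one packet to the next node (deterministic regular transmissions, delay-free links), and each packet is received with probability $p\in(0,1]$, independently over all links and time units (Bernoulli losses, identical links). In a dense code each packet of the source is a uniformly random $\mathbb F_2$-linear combination of the $k$ message vectors, and each packet of an interior node is a uniformly random $\mathbb F_2$-linear combination of the packets that this node received in earlier time units; all coefficients are independent of each other and of the losses. The coding delay is the first time at which the global encoding vectors (in $\mathbb F_2^k$) of the packets received by the sink have rank $k$. For $0<\epsilon<1$, the $\epsilon$-constrained coding delay $N_\epsilon(k,L,p)$ is the infimum of the integers $N$ such that the coding delay exceeds $N$ with probability at most $\epsilon$. Logarithms are to base $2$. **Theorem.** (1) Let $p\in(0,1]$, and let $L=L_k\ge1$ and $\epsilon=\epsilon_k\in(0,1)$ be constants, or more generally sequences with $L\log\frac{kL}{p\epsilon}=o(k)$ as $k\to\infty$ (which holds automatically for constants). Then for every real sequence $w=w_k$ with $$w\sim\Big(\frac{kL^2}{\log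 (kL/(p\epsilon))}\Big)^{1/3}\qquad(k\to\infty)$$ there is a term $o(1)$ that tends to $0$ as $k\to\infty$ such that, for all sufficiently large $k$, $N_\epsilon(k,L,p)$ is finite and $$N_\epsilon(k,L,p)\le\frac1p\left(k+(1+o(1))\left(\frac{kL}{w}+\sqrt{k\,w\log\frac{wL}{\epsilon}}+w\log\frac{wL}{\epsilon}\right)\right).$$ (2) In particular, the coding delay is $\frac1p\big(k+O((k^2L\log(kL))^{1/3})\big)$ when $\epsilon$ is constant or tends to $0$ at most polynomially fast: for every $a>0$ there is a constant $C$, depending only on $a$, such that for all $p\in(0,1]$ and all $L=L_k\ge1$, $\epsilon=\epsilon_k\in(0,1)$ (constants or sequences) with $L\log(kL)=o(k)$ and $\epsilon\ge k^{-a}$ for all large $k$, one has, for all sufficiently large $k$, $$N_\epsilon(k,L,p)\le\frac1p\Big(k+C\,\big(k^2L\log(kL)\big)^{1/3}\Big).$$ -/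

import Mathlib

open MeasureTheory ProbabilityTheory Filter Asymptotics
open scoped Topology

namespace LineNetwork

/-!
Time is slotted; slot `t : ℕ` is the time unit `(t, t + 1]`, so that the slots `t < N` are those
up to time `N`.  Node `0` is the source and link `i` joins node `i` to node `i + 1`; the line network
of `L` links consists of the nodes `0, …, L`, node `L` being the sink.  (The sample space carries
variables for all links `i : ℕ`; those with `i ≥ L` have no effect on the nodes `0, …, L`.)
-/

/-- An outcome of the traffic and of the random code, for a message of `k` vectors:
* `ω.1 (i, t)`: is the packet sent over link `i` in slot `t` received?
* `ω.2.1 (t, j)`: coefficient of message vector `j` in the packet sent by the source in slot `t`;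
* `ω.2.2 (i, t, s)`: coefficient, in the packet sent by the interior node `i + 1` in slot `t`, of
  the packet which that node received in slot `s` (used only if there is one and `s < t`). -/
abbrev Outcome (k : ℕ) : Type :=
  (ℕ × ℕ → Bool) × (ℕ × Fin k → ZMod 2) × (ℕ × ℕ × ℕ → ZMod 2)

/-- The uniform distribution on `𝔽₂`. -/
noncomputable def unifF2 : Measure (ZMod 2) := (PMF.uniformOfFintype (ZMod 2)).toMeasure

instance : IsProbabilityMeasure unifF2 := by
  unfold unifF2; infer_instance

/-- The law of an outcome: every transmission succeeds with probability `p`, every coefficient is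
uniform on `𝔽₂`, and all of these variables are independent. -/
noncomputable def law (p : unitInterval) (k : ℕ) : Measure (Outcome k) :=
  (Measure.infinitePi fun _ : ℕ × ℕ => bernoulliMeasure true false p).prod
    ((Measure.infinitePi fun _ : ℕ × Fin k => unifF2).prod
      (Measure.infinitePi fun _ : ℕ × ℕ × ℕ => unifF2))

instance (p : unitInterval) (k : ℕ) : IsProbabilityMeasure (law p k) := by
  unfold law; infer_instance

/-- The global encoding vector of the packet sent by node `i` in slot `t`: the source sends a random
linear combination of the message vectors, and every other node sends a random linear combination of
the packets that it received in earlier slots. -/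
def packet {k : ℕ} (ω : Outcome k) : ℕ → ℕ → (Fin k → ZMod 2)
  | 0, t => fun j => ω.2.1 (t, j)
  | i + 1, t => ∑ s ∈ Finset.range t,
      if ω.1 (i, s) = true then ω.2.2 (i, t, s) • packet ω i s else 0

/-- The row space of the decoding matrix of node `i` at time `N`, that is, the span of the global
encoding vectors of the packets received by time `N`; the source knows the whole message. -/
def rowSpace {k : ℕ} (ω : Outcome k) : ℕ → ℕ → Submodule (ZMod 2) (Fin k → ZMod 2)
  | 0, _ => ⊤
  | i + 1, N => Submodule.span (ZMod 2) {v | ∃ s < N, ω.1 (i, s) = true ∧ packet ω i s = v}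

/-- The coding delay over `L` links: the first time at which the decoding matrix of the sink has
rank `k` (`⊤` if there is none). -/
noncomputable def codingDelay {k : ℕ} (L : ℕ) (ω : Outcome k) : ℕ∞ :=
  sInf {n : ℕ∞ | ∃ N : ℕ, n = N ∧ Module.finrank (ZMod 2) (rowSpace ω L N) = k}

/-- The `ε`-constrained coding delay: the infimum of the `N` such that the coding delay exceeds `N`
with probability at most `ε` (`⊤` if there is none). -/
noncomputable def epsCodingDelay (p : unitInterval) (L k : ℕ) (ε : ℝ) : ℕ∞ :=
  sInf {n : ℕ∞ | ∃ N : ℕ, n = N ∧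
    law p k {ω | (N : ℕ∞) < codingDelay L ω} ≤ ENNReal.ofReal ε}

end LineNetwork

namespace LineNetwork

/-! If the sink cannot decode by time `N`, some nonzero `u` is orthogonal to every packet it has
received. Fix `u` and watch link `0`, moving to the next link whenever a packet not orthogonal to
`u` arrives over the watched one. The path never passes the last link, so its set `J` of jump times
has at most `L - 1` elements (`exists_follows`), and at most `(N + 1) ^ (L - 1)` sets are possible.

Fix `u`, `J` and the losses. The sender on the watched link always holds something not orthogonal to
`u`: the message itself, or the packet of the last jump. A fresh uniform coefficient of it makes the
product of `u` with each received watched packet a fair coin, so `J` is followed with probability at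
most `2 ^ (-R)`, where `R` counts the received watched packets (`coeffLaw_follows_le`). As `J` is
fixed, `R` is binomial with parameters `N` and `p`, and Hoeffding's inequality bounds its lower
tail.

A union bound over `J` and `u` gives `law_codingDelay_gt_le`. With `y` defined by `L log (kL/(pε)) =
k y ^ 3`, an excess of order `k y` over `k` makes each error term beat the number of paths
(`epsCodingDelay_le`); both parts of the theorem follow from this. -/

/-! ### Watched paths -/

/-- The link watched in slot `s` along the path that moves to the next link after each slot
of `J`. -/
def link (J : Finset ℕ) (s : ℕ) : ℕ := (J.filter (· < s)).card

/-- The last slot of `J` before `s`. -/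
def lastJump (J : Finset ℕ) (s : ℕ) : ℕ := (J.filter (· < s)).sup id

/-- Up to time `N`, the path given by `J` moves exactly after the slots in which a packet not
orthogonal to `u` is received over the watched link. -/
def Follows {k : ℕ} (u : Fin k → ZMod 2) (N : ℕ) (J : Finset ℕ) (ω : Outcome k) : Prop :=
  ∀ s < N, (s ∈ J → ω.1 (link J s, s) = true) ∧
    (ω.1 (link J s, s) = true → u ⬝ᵥ packet ω (link J s) s = if s ∈ J then 1 else 0)

lemma link_insert_of_le {J : Finset ℕ} {n s : ℕ} (h : s ≤ n) : link (insert n J) s = link J s := by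
  unfold link
  rw [Finset.filter_insert, if_neg (by omega)]

lemma link_of_subset_range {J : Finset ℕ} {n : ℕ} (h : J ⊆ Finset.range n) :
    link J n = J.card := by
  unfold link
  rw [Finset.filter_true_of_mem fun x hx => Finset.mem_range.1 (h hx)]

/-- The latest jump led onto the current link, hence was made from the previous one. The supremum's
default value `0` plays no role, since a positive link index forces a jump. -/
lemma lastJump_spec {J : Finset ℕ} {i s : ℕ} (h : link J s = i + 1) :
    lastJump J s ∈ J ∧ lastJump J s < s ∧ link J (lastJump J s) = i := by
  have hne : (J.filter (· < s)).Nonempty := by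
    rw [← Finset.card_pos]; unfold link at h; omega
  obtain ⟨m, hm, hsup⟩ := Finset.exists_mem_eq_sup _ hne id
  have hl : lastJump J s = m := hsup
  have hle : ∀ x ∈ J.filter (· < s), x ≤ m := fun x hx => by
    have := Finset.le_sup (f := id) hx
    rw [hsup] at this
    exact this
  rw [hl]
  have hm' := Finset.mem_filter.1 hm
  refine ⟨hm'.1, hm'.2, ?_⟩
  have : J.filter (· < m) = (J.filter (· < s)).erase m := by
    ext x
    simp only [Finset.mem_filter, Finset.mem_erase]
    constructor
    · rintro ⟨hx, hxm⟩
      exact ⟨hxm.ne, hx, hxm.trans hm'.2⟩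
    · rintro ⟨hne, hx, hxs⟩
      exact ⟨hx, lt_of_le_of_ne (hle x (Finset.mem_filter.2 ⟨hx, hxs⟩)) hne⟩
  unfold link at h ⊢
  rw [this, Finset.card_erase_of_mem hm, h]
  rfl

lemma zmod_two_eq_one {x : ZMod 2} (h : x ≠ 0) : x = 1 := by
  revert x; decide

lemma exists_follows {k : ℕ} (u : Fin k → ZMod 2) (ω : Outcome k) (l N : ℕ)
    (h : ∀ s < N, ω.1 (l, s) = true → u ⬝ᵥ packet ω l s = 0) :
    ∃ J : Finset ℕ, J ⊆ Finset.range N ∧ J.card ≤ l ∧ Follows u N J ω := by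
  induction N with
  | zero => exact ⟨∅, by simp, by simp, fun s hs => by omega⟩
  | succ n ih =>
    obtain ⟨J, hJ, hc, hf⟩ := ih fun s hs => h s (by omega)
    have hn : n ∉ J := fun hn => by simpa using hJ hn
    have hlink := link_of_subset_range hJ
    have hJ' : J ⊆ Finset.range (n + 1) := hJ.trans (Finset.range_mono (Nat.le_succ n))
    by_cases hj : ω.1 (link J n, n) = true ∧ u ⬝ᵥ packet ω (link J n) n ≠ 0
    -- A jump away from link `l` would need a received packet there not orthogonal to `u`.
    · have hcl : J.card ≠ l := by
        intro hcl
        rw [hlink, hcl] at hj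
        exact hj.2 (h n (by omega) hj.1)
      refine ⟨insert n J, Finset.insert_subset (by simp) hJ', ?_, ?_⟩
      · rw [Finset.card_insert_of_notMem hn]; omega
      · intro s hs
        rw [link_insert_of_le (by omega)]
        rcases Nat.lt_succ_iff_lt_or_eq.1 hs with hs | rfl
        · simpa [hs.ne] using hf s hs
        · exact ⟨fun _ => hj.1, fun _ => by simpa using zmod_two_eq_one hj.2⟩
    · refine ⟨J, hJ', hc, ?_⟩
      intro s hs
      rcases Nat.lt_succ_iff_lt_or_eq.1 hs with hs | rfl
      · exact hf s hs
      · refine ⟨fun h' => absurd h' hn, fun h' => ?_⟩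
        rw [if_neg hn]
        by_contra h0
        exact hj ⟨h', h0⟩

/-! ### Translating the coefficients -/

lemma packet_congr {k : ℕ} {ω ω' : Outcome k} {T : ℕ} (he : ω.1 = ω'.1)
    (h1 : ∀ t ≤ T, ∀ j, ω.2.1 (t, j) = ω'.2.1 (t, j))
    (h2 : ∀ t ≤ T, ∀ i s, ω.2.2 (i, t, s) = ω'.2.2 (i, t, s)) (i : ℕ) :
    ∀ t ≤ T, packet ω i t = packet ω' i t := by
  induction i with
  | zero => intro t ht; funext j; simpa [packet] using h1 t ht j
  | succ i ih =>
    intro t ht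
    simp only [packet]
    refine Finset.sum_congr rfl fun s hs => ?_
    rw [he, h2 t ht, ih s (by have := Finset.mem_range.1 hs; omega)]

/-- The change of coefficients that adds `d s` to the coordinate of slot `s` which decides whether
the packet watched in slot `s` is orthogonal to `u`; here `u j₀ ≠ 0`. -/
def shift {k : ℕ} (J : Finset ℕ) (j₀ : Fin k) (d : ℕ → ZMod 2) :
    (ℕ × Fin k → ZMod 2) × (ℕ × ℕ × ℕ → ZMod 2) :=
  (fun x => if link J x.1 = 0 ∧ x.2 = j₀ then d x.1 else 0,
    fun x => if link J x.2.1 = x.1 + 1 ∧ x.2.2 = lastJump J x.2.1 then d x.2.1 else 0)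

lemma shift_sub {k : ℕ} (J : Finset ℕ) (j₀ : Fin k) (d d' : ℕ → ZMod 2) :
    shift J j₀ (d - d') = shift J j₀ d - shift J j₀ d' := by
  unfold shift
  ext x <;> simp <;> split_ifs <;> simp

/-- At the first slot where `d` is nonzero all earlier packets are unchanged, while the watched
packet gains a summand whose product with `u` is `1`. This flips a value that `J` prescribes. -/
lemma follows_shift {k : ℕ} {u : Fin k → ZMod 2} {j₀ : Fin k} (hu : u j₀ ≠ 0) {N : ℕ}
    {J : Finset ℕ} {e : ℕ × ℕ → Bool} {c : (ℕ × Fin k → ZMod 2) × (ℕ × ℕ × ℕ → ZMod 2)}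
    {d : ℕ → ZMod 2} (hd : ∀ s, d s ≠ 0 → s < N ∧ e (link J s, s) = true)
    (h : Follows u N J (e, c)) (h' : Follows u N J (e, c + shift J j₀ d)) : d = 0 := by
  funext s
  induction s using Nat.strong_induction_on with
  | _ s ih =>
    by_contra hs
    obtain ⟨hsN, hes⟩ := hd s hs
    have hds := zmod_two_eq_one hs
    have hpast : ∀ i, ∀ t < s, packet (e, c + shift J j₀ d) i t = packet (e, c) i t := by
      intro i t ht
      refine packet_congr (ω := (e, c + shift J j₀ d)) (ω' := (e, c)) (T := t) rfl ?_ ?_ i t le_rfl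
      · intro t' ht' j
        have : d t' = 0 := ih t' (by omega)
        simp [shift, this]
      · intro t' ht' i s
        have : d t' = 0 := ih t' (by omega)
        simp [shift, this]
    have e1 := (h s hsN).2 hes
    have e2 := (h' s hsN).2 hes
    rw [← e1] at e2
    suffices hne : u ⬝ᵥ packet (e, c + shift J j₀ d) (link J s) s =
        u ⬝ᵥ packet (e, c) (link J s) s + 1 by
      rw [hne] at e2
      simp at e2
    rcases hi : link J s with _ | i
    · have : packet (e, c + shift J j₀ d) 0 s = packet (e, c) 0 s + Pi.single j₀ 1 := by
        funext j
        simp [packet, shift, hi, hds, Pi.single_apply]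
      rw [this, dotProduct_add, dotProduct_single, zmod_two_eq_one hu, mul_one]
    · obtain ⟨hJ, hlt, hl⟩ := lastJump_spec hi
      have hj := h _ (hlt.trans hsN)
      rw [hl] at hj
      have hrec : e (i, lastJump J s) = true := hj.1 hJ
      have hval := hj.2 hrec
      rw [if_pos hJ] at hval
      have : packet (e, c + shift J j₀ d) (i + 1) s =
          packet (e, c) (i + 1) s + packet (e, c) i (lastJump J s) := by
        have hterm : ∀ t ∈ Finset.range s,
            (if e (i, t) = true then (c + shift J j₀ d).2 (i, s, t) •
              packet (e, c + shift J j₀ d) i t else 0) =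
            (if e (i, t) = true then c.2 (i, s, t) • packet (e, c) i t else 0) +
              if t = lastJump J s then packet (e, c) i (lastJump J s) else 0 := by
          intro t ht
          rw [hpast i t (Finset.mem_range.1 ht)]
          by_cases htl : t = lastJump J s
          · subst htl
            simp [hrec, shift, hi, hds, add_smul]
          · simp [shift, htl]
        simp only [packet]
        rw [Finset.sum_congr rfl hterm, Finset.sum_add_distrib, Finset.sum_ite_eq',
          if_pos (Finset.mem_range.2 hlt)]
      rw [this, dotProduct_add, hval]

/-! ### Translation invariance and measurability -/

lemma unifF2_map_add (a : ZMod 2) : unifF2.map (· + a) = unifF2 := by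
  ext s hs
  rw [Measure.map_apply (measurable_of_countable _) hs]
  classical
  unfold unifF2
  rw [PMF.toMeasure_uniformOfFintype_apply _ MeasurableSet.of_discrete,
    PMF.toMeasure_uniformOfFintype_apply _ hs]
  congr 2
  exact Fintype.card_congr ((Equiv.addRight a).subtypeEquiv fun x => by simp)

lemma measurePreserving_add_infinitePi_unifF2 {ι : Type*} (v : ι → ZMod 2) :
    MeasurePreserving (fun x : ι → ZMod 2 => x + v) (Measure.infinitePi fun _ => unifF2)
      (Measure.infinitePi fun _ => unifF2) := by
  have hm : ∀ i, Measurable (fun x : ZMod 2 => x + v i) := fun i => measurable_of_countable _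
  refine ⟨measurable_pi_lambda _ fun i => (hm i).comp (measurable_pi_apply i), ?_⟩
  have := Measure.infinitePi_map_pi (fun _ : ι => unifF2) hm
  simp only [unifF2_map_add] at this
  exact this

/-- The law of the coefficients. -/
noncomputable def coeffLaw (k : ℕ) : Measure ((ℕ × Fin k → ZMod 2) × (ℕ × ℕ × ℕ → ZMod 2)) :=
  (Measure.infinitePi fun _ : ℕ × Fin k => unifF2).prod
    (Measure.infinitePi fun _ : ℕ × ℕ × ℕ => unifF2)

instance (k : ℕ) : IsProbabilityMeasure (coeffLaw k) := by
  unfold coeffLaw; infer_instance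

/-- The law of the losses. -/
noncomputable def lossLaw (p : unitInterval) : Measure (ℕ × ℕ → Bool) :=
  Measure.infinitePi fun _ => bernoulliMeasure true false p

instance (p : unitInterval) : IsProbabilityMeasure (lossLaw p) := by
  unfold lossLaw; infer_instance

lemma law_eq_prod (p : unitInterval) (k : ℕ) : law p k = (lossLaw p).prod (coeffLaw k) := rfl

lemma measurePreserving_add_coeffLaw {k : ℕ}
    (v : (ℕ × Fin k → ZMod 2) × (ℕ × ℕ × ℕ → ZMod 2)) :
    MeasurePreserving (fun c => c + v) (coeffLaw k) (coeffLaw k) :=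
  (measurePreserving_add_infinitePi_unifF2 v.1).prod (measurePreserving_add_infinitePi_unifF2 v.2)

lemma measurableSet_receives {k : ℕ} (x : ℕ × ℕ) :
    MeasurableSet {ω : Outcome k | ω.1 x = true} := by
  have : Measurable fun ω : Outcome k => ω.1 x := (measurable_pi_apply x).comp measurable_fst
  exact this (MeasurableSet.of_discrete (s := {true}))

lemma measurable_packet {k : ℕ} (i t : ℕ) :
    Measurable fun ω : Outcome k => packet ω i t := by
  induction i generalizing t with
  | zero =>
    simp only [packet]
    fun_prop
  | succ i ih =>
    simp only [packet]
    refine Finset.measurable_sum _ fun s _ => ?_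
    refine Measurable.ite ?_ ?_ measurable_const
    · exact measurableSet_receives _
    · refine measurable_pi_lambda _ fun j => ?_
      have h1 : Measurable fun ω : Outcome k => (ω.2.2 (i, t, s), packet ω i s j) :=
        (measurable_snd.snd.eval).prodMk ((ih s).eval)
      exact (measurable_of_countable fun x : ZMod 2 × ZMod 2 => x.1 * x.2).comp h1

lemma measurableSet_follows {k : ℕ} (u : Fin k → ZMod 2) (N : ℕ) (J : Finset ℕ) :
    MeasurableSet {ω : Outcome k | Follows u N J ω} := by
  have hp : ∀ i s (a : ZMod 2), MeasurableSet {ω : Outcome k | u ⬝ᵥ packet ω i s = a} := by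
    intro i s a
    have : Measurable fun ω : Outcome k => u ⬝ᵥ packet ω i s :=
      (measurable_of_countable fun v => u ⬝ᵥ v).comp (measurable_packet i s)
    exact this (MeasurableSet.of_discrete (s := {a}))
  unfold Follows
  simp only [Set.ofPred_forall]
  refine MeasurableSet.iInter fun s => MeasurableSet.iInter fun _ => ?_
  refine MeasurableSet.inter ?_ ?_
  · exact (MeasurableSet.const _).imp (measurableSet_receives _)
  · exact (measurableSet_receives _).imp (hp _ _ _)

/-! ### Probability bounds for a fixed path -/

/-- The number of packets received over the watched links up to time `N`. -/
def received (N : ℕ) (J : Finset ℕ) (e : ℕ × ℕ → Bool) : ℕ :=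
  ((Finset.range N).filter fun s => e (link J s, s) = true).card

/-- Each binary vector on the received watched slots defines a translate of the event. The
translates have equal measure and are disjoint by `follows_shift`, so their total mass is at most
`1`. This replaces conditioning on the past. -/
lemma coeffLaw_follows_le {k : ℕ} {u : Fin k → ZMod 2} (hu : u ≠ 0) (N : ℕ) (J : Finset ℕ)
    (e : ℕ × ℕ → Bool) :
    coeffLaw k {c | Follows u N J (e, c)} ≤ (2 ^ received N J e)⁻¹ := by
  obtain ⟨j₀, hj₀⟩ := Function.ne_iff.1 hu
  set R := (Finset.range N).filter fun s => e (link J s, s) = true with hR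
  set A := {c | Follows u N J (e, c)} with hA
  have hAm : MeasurableSet A := measurable_prodMk_left (measurableSet_follows u N J)
  let ext : (R → ZMod 2) → ℕ → ZMod 2 := fun d s => if h : s ∈ R then d ⟨s, h⟩ else 0
  have key := sum_measure_le_measure_univ (μ := coeffLaw k) (s := Finset.univ)
    (t := fun d : R → ZMod 2 => (fun c => c + shift J j₀ (ext d)) ⁻¹' A)
    (fun d _ => ((measurePreserving_add_coeffLaw _).measurable hAm).nullMeasurableSet) ?_
  · simp only [(measurePreserving_add_coeffLaw _).measure_preimage hAm.nullMeasurableSet,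
      measure_univ, Finset.sum_const, Finset.card_univ, Fintype.card_fun, ZMod.card,
      Fintype.card_coe, nsmul_eq_mul, Nat.cast_pow, Nat.cast_ofNat] at key
    rw [ENNReal.le_inv_iff_mul_le, mul_comm]
    exact key
  · intro d _ d' _ hne
    refine Disjoint.aedisjoint (Set.disjoint_left.2 fun c hc hc' => hne ?_)
    have hc2 : c + shift J j₀ (ext d) =
        c + shift J j₀ (ext d') + shift J j₀ (ext d - ext d') := by
      rw [shift_sub]; abel
    simp only [Set.mem_preimage, hA, Set.mem_ofPred_eq] at hc hc'
    rw [hc2] at hc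
    have h0 := follows_shift hj₀ (d := ext d - ext d') ?_ hc' hc
    · funext s
      have := congrFun h0 s
      simpa [ext, sub_eq_zero] using this
    · intro s hs
      by_contra hcon
      have : s ∉ R := fun h => hcon (by simpa [hR] using h)
      simp [ext, this] at hs

lemma lossLaw_received_lt_le (p : unitInterval) (N m : ℕ) (J : Finset ℕ)
    (hm : (m : ℝ) ≤ p * N) :
    lossLaw p {e | received N J e < m} ≤
      ENNReal.ofReal (Real.exp (-2 * (p * N - m) ^ 2 / N)) := by
  -- The sign turns the lower tail of the count into an upper tail.
  let f : Bool → ℝ := fun b => if b = true then -1 else 0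
  have hf : ∫ b, f b ∂(bernoulliMeasure true false p) = -p := by
    rw [integral_bernoulliMeasure]
    simp [f]
  let X : ℕ → (ℕ × ℕ → Bool) → ℝ := fun s e => f (e (link J s, s)) - (-p)
  have hfm : Measurable f := measurable_of_countable _
  have hXi : iIndepFun X (lossLaw p) := by
    have h0 := iIndepFun_infinitePi (P := fun _ : ℕ × ℕ => bernoulliMeasure true false p)
      (X := fun _ b => f b - (-p)) (fun _ => hfm.sub_const _)
    -- Distinct slots use distinct loss variables, whichever links are watched.
    exact h0.precomp (g := fun s : ℕ => (link J s, s)) fun a b hab => (Prod.ext_iff.1 hab).2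
  have hint : ∀ s, ∫ e, f (e (link J s, s)) ∂(lossLaw p) = -p := by
    intro s
    rw [← hf]
    have := (measurePreserving_eval_infinitePi (fun _ : ℕ × ℕ => bernoulliMeasure true false p)
      (link J s, s))
    rw [← this.map_eq, integral_map this.measurable.aemeasurable hfm.aestronglyMeasurable]
    rfl
  have hsub : ∀ s < N, HasSubgaussianMGF (X s) ((‖(0 : ℝ) - (-1)‖₊ / 2) ^ 2) (lossLaw p) := by
    intro s _
    have := hasSubgaussianMGF_of_mem_Icc (μ := lossLaw p) (a := -1) (b := 0)
      (X := fun e => f (e (link J s, s)))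
      (hfm.comp (measurable_pi_apply _)).aemeasurable
      (Eventually.of_forall fun e => by
        simp only [f]; split_ifs <;> simp)
    rw [hint] at this
    exact this
  have hH := HasSubgaussianMGF.measure_sum_range_ge_le_of_iIndepFun hXi hsub
    (sub_nonneg.2 hm)
  have hset : {e | received N J e < m} ⊆ {e | (p : ℝ) * N - m ≤ ∑ s ∈ Finset.range N, X s e} := by
    intro e he
    have h1 : ∑ s ∈ Finset.range N, X s e = p * N - received N J e := by
      simp only [X, f, received, Finset.sum_sub_distrib, Finset.sum_ite, Finset.sum_const]
      simp
      ring
    have h2 : (received N J e : ℝ) < m := by exact_mod_cast he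
    simp only [Set.mem_ofPred_eq, h1]
    linarith
  refine (measure_mono hset).trans ?_
  rw [← ENNReal.ofReal_toReal (measure_ne_top (lossLaw p) _)]
  refine ENNReal.ofReal_le_ofReal (hH.trans (le_of_eq ?_))
  congr 1
  rcases Nat.eq_zero_or_pos N with rfl | hN
  · simp
  · have : (N : ℝ) ≠ 0 := by positivity
    simp
    field_simp

/-! ### Union bound over `u` and the paths -/

lemma exists_ne_zero_of_codingDelay_gt {k l N : ℕ} {ω : Outcome k}
    (h : (N : ℕ∞) < codingDelay (l + 1) ω) :
    ∃ u : Fin k → ZMod 2, u ≠ 0 ∧ ∀ s < N, ω.1 (l, s) = true → u ⬝ᵥ packet ω l s = 0 := by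
  have hr : Module.finrank (ZMod 2) (rowSpace ω (l + 1) N) ≠ k := by
    intro hr
    refine absurd ?_ (not_le.2 h)
    unfold codingDelay
    exact sInf_le ⟨N, rfl, hr⟩
  have htop : rowSpace ω (l + 1) N < ⊤ := by
    refine lt_top_iff_ne_top.2 fun ht => hr ?_
    rw [ht, finrank_top, Module.finrank_fin_fun]
  obtain ⟨f, hf, hle⟩ := Submodule.exists_le_ker_of_lt_top _ htop
  have hfd : ∀ v, f v = (fun j => f (Pi.single j 1)) ⬝ᵥ v := fun v => by
    rw [LinearMap.pi_apply_eq_sum_univ f v, dotProduct]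
    refine Finset.sum_congr rfl fun j _ => ?_
    rw [smul_eq_mul, mul_comm]
    congr 2
    ext i
    simp [Pi.single_apply, eq_comm]
  refine ⟨fun j => f (Pi.single j 1), fun h0 => hf ?_, fun s hs hrec => ?_⟩
  · refine LinearMap.ext fun v => ?_
    rw [hfd, h0]
    exact zero_dotProduct v
  · rw [← hfd]
    exact LinearMap.mem_ker.1 (hle (Submodule.subset_span ⟨s, hs, hrec, rfl⟩))

/-- The sets of at most `l` slots before `N`. -/
def jumpSets (N l : ℕ) : Finset (Finset ℕ) := (Finset.range N).powerset.filter (·.card ≤ l)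

lemma card_jumpSets_le (N l : ℕ) : (jumpSets N l).card ≤ (N + 1) ^ l := by
  have hsub : jumpSets N l ⊆
      (Finset.range (l + 1)).biUnion fun j => (Finset.range N).powersetCard j := by
    intro J hJ
    simp only [jumpSets, Finset.mem_filter, Finset.mem_powerset] at hJ
    simp only [Finset.mem_biUnion, Finset.mem_range, Finset.mem_powersetCard]
    exact ⟨J.card, by omega, hJ.1, rfl⟩
  calc (jumpSets N l).card ≤ ∑ j ∈ Finset.range (l + 1), N.choose j := by
        refine (Finset.card_le_card hsub).trans (Finset.card_biUnion_le.trans (le_of_eq ?_))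
        simp [Finset.card_powersetCard]
    -- The extra binomial factors, each at least `1`, complete the expansion of `(N + 1) ^ l`.
    _ ≤ ∑ j ∈ Finset.range (l + 1), N ^ j * 1 ^ (l - j) * l.choose j := by
        refine Finset.sum_le_sum fun j hj => ?_
        have : 0 < l.choose j := Nat.choose_pos (by have := Finset.mem_range.1 hj; omega)
        rw [one_pow, mul_one]
        exact (Nat.choose_le_pow N j).trans (Nat.le_mul_of_pos_right _ this)
    _ = (N + 1) ^ l := (add_pow N 1 l).symm

lemma measurable_received (N : ℕ) (J : Finset ℕ) : Measurable (received N J) := by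
  have hset : ∀ s, MeasurableSet {e : ℕ × ℕ → Bool | e (link J s, s) = true} := fun s => by
    have : Measurable fun e : ℕ × ℕ → Bool => e (link J s, s) := measurable_pi_apply _
    exact this (MeasurableSet.of_discrete (s := {true}))
  have : received N J = fun e => ∑ s ∈ Finset.range N, if e (link J s, s) = true then 1 else 0 :=
    funext fun e => Finset.card_filter _ _
  rw [this]
  exact Finset.measurable_sum _ fun s _ =>
    Measurable.ite (hset s) measurable_const measurable_const

lemma law_follows_le {k : ℕ} (p : unitInterval) {u : Fin k → ZMod 2} (hu : u ≠ 0) (N m : ℕ)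
    (J : Finset ℕ) :
    law p k {ω | Follows u N J ω ∧ m ≤ received N J ω.1} ≤ (2 ^ m)⁻¹ := by
  have hms : MeasurableSet {ω : Outcome k | Follows u N J ω ∧ m ≤ received N J ω.1} := by
    refine (measurableSet_follows u N J).inter ?_
    exact ((measurable_received N J).comp measurable_fst)
      (MeasurableSet.of_discrete (s := {n | m ≤ n}))
  rw [law_eq_prod, Measure.prod_apply hms]
  calc ∫⁻ e, coeffLaw k (Prod.mk e ⁻¹' {ω : Outcome k | Follows u N J ω ∧ m ≤ received N J ω.1})
        ∂(lossLaw p)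
      ≤ ∫⁻ _, (2 ^ m)⁻¹ ∂(lossLaw p) := by
        refine lintegral_mono fun e => ?_
        by_cases h : m ≤ received N J e
        · refine (measure_mono fun c hc => hc.1).trans
            ((coeffLaw_follows_le hu N J e).trans ?_)
          exact ENNReal.inv_le_inv.2 (pow_le_pow_right₀ (by norm_num) h)
        · have : Prod.mk e ⁻¹' {ω : Outcome k | Follows u N J ω ∧ m ≤ received N J ω.1} = ∅ :=
            Set.eq_empty_of_forall_notMem fun c hc => h hc.2
          rw [this]
          simp
    _ = (2 ^ m)⁻¹ := by simp

lemma law_codingDelay_gt_le (p : unitInterval) (k l N m : ℕ) (hm : (m : ℝ) ≤ p * N) :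
    law p k {ω | (N : ℕ∞) < codingDelay (l + 1) ω} ≤
      (N + 1) ^ l * (ENNReal.ofReal (Real.exp (-2 * (p * N - m) ^ 2 / N)) +
        2 ^ k * (2 ^ m)⁻¹) := by
  classical
  set U : Finset (Fin k → ZMod 2) := Finset.univ.filter (· ≠ 0)
  have hsub : {ω : Outcome k | (N : ℕ∞) < codingDelay (l + 1) ω} ⊆
      ⋃ J ∈ jumpSets N l, ({e | received N J e < m} ×ˢ Set.univ ∪
        ⋃ u ∈ U, {ω | Follows u N J ω ∧ m ≤ received N J ω.1}) := by
    intro ω hω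
    obtain ⟨u, hu, h0⟩ := exists_ne_zero_of_codingDelay_gt hω
    obtain ⟨J, hJ, hc, hf⟩ := exists_follows u ω l N h0
    refine Set.mem_biUnion (x := J) (by simp [jumpSets, hJ, hc]) ?_
    by_cases hr : received N J ω.1 < m
    · exact Or.inl ⟨hr, trivial⟩
    · exact Or.inr (Set.mem_biUnion (x := u) (by simp [U, hu]) ⟨hf, not_lt.1 hr⟩)
  have hU : (U.card : ENNReal) ≤ 2 ^ k := by
    have : U.card ≤ 2 ^ k := by
      refine (Finset.card_le_univ _).trans (le_of_eq ?_)
      rw [Fintype.card_fun, ZMod.card, Fintype.card_fin]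
    exact_mod_cast this
  have hF : ((jumpSets N l).card : ENNReal) ≤ (N + 1) ^ l := by
    exact_mod_cast card_jumpSets_le N l
  refine (measure_mono hsub).trans ((measure_biUnion_finset_le _ _).trans ?_)
  calc _ ≤ ∑ J ∈ jumpSets N l, (ENNReal.ofReal (Real.exp (-2 * (p * N - m) ^ 2 / N)) +
        2 ^ k * (2 ^ m)⁻¹) := by
        refine Finset.sum_le_sum fun J _ => (measure_union_le _ _).trans (add_le_add ?_ ?_)
        · rw [law_eq_prod, Measure.prod_prod, measure_univ, mul_one]
          exact lossLaw_received_lt_le p N m J hm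
        · refine (measure_biUnion_finset_le _ _).trans ?_
          calc _ ≤ ∑ u ∈ U, ((2 : ENNReal) ^ m)⁻¹ := Finset.sum_le_sum fun u hu =>
                law_follows_le p (Finset.mem_filter.1 hu).2 N m J
            _ ≤ _ := by
                rw [Finset.sum_const, nsmul_eq_mul]
                gcongr
    _ ≤ _ := by
        rw [Finset.sum_const, nsmul_eq_mul]
        gcongr

lemma law_codingDelay_gt_le_ofReal (p : unitInterval) (k l N m : ℕ) (hm : (m : ℝ) ≤ p * N) :
    law p k {ω | (N : ℕ∞) < codingDelay (l + 1) ω} ≤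
      ENNReal.ofReal (((N : ℝ) + 1) ^ l * (Real.exp (-2 * (p * N - m) ^ 2 / N) +
        2 ^ k * (2 ^ m)⁻¹)) := by
  refine (law_codingDelay_gt_le p k l N m hm).trans (le_of_eq ?_)
  rw [ENNReal.ofReal_mul (by positivity), ENNReal.ofReal_add (by positivity) (by positivity),
    ENNReal.ofReal_mul (by positivity), ENNReal.ofReal_inv_of_pos (by positivity),
    ENNReal.ofReal_pow (by positivity), ENNReal.ofReal_pow (by positivity),
    ENNReal.ofReal_pow (by positivity), ENNReal.ofReal_add (by positivity) (by positivity)]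
  simp

/-! ### Choice of parameters -/

lemma one_le_logb {p ε : ℝ} {k L : ℕ} (hp : 0 < p) (hp1 : p ≤ 1) (hε : 0 < ε) (hε1 : ε < 1)
    (hk : 64 ≤ k) (hL : 1 ≤ L) :
    (64 : ℝ) ≤ k * L / (p * ε) ∧ 1 ≤ Real.logb 2 (k * L / (p * ε)) := by
  have hk' : (64 : ℝ) ≤ k := by exact_mod_cast hk
  have hL' : (1 : ℝ) ≤ L := by exact_mod_cast hL
  have h64 : (64 : ℝ) ≤ k * L / (p * ε) := by
    rw [le_div_iff₀ (by positivity)]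
    nlinarith [mul_le_one₀ hp1 hε.le hε1.le]
  refine ⟨h64, ?_⟩
  rw [Real.le_logb_iff_rpow_le one_lt_two (by linarith)]
  simpa using by linarith

/-- The Hoeffding exponent is at least `κ y ^ 2 P / 64`, which exceeds the required `2 κ y ^ 3 log
2` because `y ≤ P / 256`. -/
lemma exp_neg_sq_div_le {P y N g κ : ℝ} (hκ : 0 ≤ κ) (hN : 0 < N) (hPN : P * N ≤ 2 * κ)
    (hy : 0 ≤ y) (hyP : y ≤ P / 256) (hg : κ * y / 8 ≤ g) :
    Real.exp (-2 * g ^ 2 / N) ≤ (2 ^ (2 * (κ * y ^ 3)))⁻¹ := by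
  rw [← Real.rpow_neg two_pos.le, Real.rpow_def_of_pos two_pos]
  refine Real.exp_le_exp.2 ?_
  have hsq : (κ * y / 8) ^ 2 ≤ g ^ 2 := by gcongr
  have hlog2 : Real.log 2 ≤ 1 := by linarith [Real.log_two_lt_d9]
  have hyN : y * N ≤ κ / 128 := by
    have := mul_le_mul_of_nonneg_right hyP hN.le
    linarith
  have h1 : Real.log 2 * (2 * (κ * y ^ 3)) ≤ 1 * (2 * (κ * y ^ 3)) := by gcongr
  have h2 : 2 * (κ * y ^ 2) * (y * N) ≤ 2 * (κ * y ^ 2) * (κ / 128) := by gcongr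
  have h3 : 0 ≤ (κ * y) ^ 2 := sq_nonneg _
  have h4 := mul_le_mul_of_nonneg_right h1 hN.le
  rw [div_le_iff₀ hN]
  linarith

/-- With `Z = k (l + 1) / (P ε)`, both `N + 1 ≤ Z ^ 2` and `2 ≤ ε Z ^ 2` hold; the spare square pays
for the two error terms and for `ε`. -/
lemma pow_mul_two_le {P ε : ℝ} {k l N : ℕ} (hP : 0 < P) (hP1 : P ≤ 1) (hk : (64 : ℝ) ≤ k)
    (hε : 0 < ε) (hε1 : ε < 1) (hN : P * N ≤ 2 * k) :
    ((N : ℝ) + 1) ^ l * 2 ≤ ε * (k * (l + 1 : ℕ) / (P * ε)) ^ (2 * (l + 1)) := by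
  set Z : ℝ := k * (l + 1 : ℕ) / (P * ε) with hZ
  have hkP : 64 ≤ (k : ℝ) / P := by rw [le_div_iff₀ hP]; linarith
  have hεZ : ε * Z = k / P * (l + 1 : ℕ) := by rw [hZ]; field_simp
  have hkZ : (k : ℝ) / P ≤ ε * Z := by
    rw [hεZ]
    refine le_mul_of_one_le_right (by positivity) ?_
    push_cast
    linarith [(Nat.cast_nonneg l : (0 : ℝ) ≤ l)]
  have hZpos : 0 < Z := pos_of_mul_pos_right (by linarith : 0 < ε * Z) hε.le
  have hkZ' : (k : ℝ) / P ≤ Z := hkZ.trans (mul_le_of_le_one_left hZpos.le hε1.le)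
  have hN1 : (N : ℝ) + 1 ≤ 3 * (k / P) := by
    have h1 : (N : ℝ) ≤ 2 * (k / P) := by
      rw [mul_div_assoc', le_div_iff₀ hP]; linarith
    linarith
  have hNZ : (N : ℝ) + 1 ≤ Z ^ 2 := by
    have : 64 * Z ≤ Z * Z := mul_le_mul_of_nonneg_right (by linarith) hZpos.le
    rw [sq]
    linarith
  have h2Z : (2 : ℝ) ≤ ε * Z ^ 2 := by
    have : 64 * 64 ≤ ε * Z * Z := mul_le_mul (by linarith) (by linarith) (by norm_num) (by linarith)
    rw [sq, ← mul_assoc]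
    linarith
  calc ((N : ℝ) + 1) ^ l * 2 ≤ (Z ^ 2) ^ l * (ε * Z ^ 2) := by gcongr
    _ = ε * Z ^ (2 * (l + 1)) := by ring

lemma epsCodingDelay_le {p : unitInterval} {k L : ℕ} {ε y : ℝ} (hp : 0 < (p : ℝ))
    (hk : 64 ≤ k) (hL : 1 ≤ L) (hε : 0 < ε) (hε1 : ε < 1) (hy : 0 ≤ y) (hyp : y ≤ p / 256)
    (h : L * Real.logb 2 (k * L / (p * ε)) = k * y ^ 3) :
    ∃ N : ℕ, epsCodingDelay p L k ε = N ∧ (N : ℝ) ≤ 1 / (p : ℝ) * (k + k * y / 2) := by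
  have hp1 : (p : ℝ) ≤ 1 := p.2.2
  obtain ⟨h64, hlog⟩ := one_le_logb (L := L) hp hp1 hε hε1 hk hL
  set P : ℝ := (p : ℝ) with hP
  set Z : ℝ := k * L / (P * ε) with hZ
  have hk' : (64 : ℝ) ≤ k := by exact_mod_cast hk
  have hL' : (1 : ℝ) ≤ L := by exact_mod_cast hL
  have hT8 : 8 ≤ k * y := by
    have h1 : 1 ≤ k * y ^ 3 := by rw [← h]; nlinarith
    have h3 : (8 : ℝ) ^ 3 ≤ (k * y) ^ 3 := by
      have : (k * y) ^ 3 = k ^ 2 * (k * y ^ 3) := by ring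
      rw [this]
      nlinarith
    exact le_of_pow_le_pow_left₀ (by norm_num) (by positivity) h3
  have hTk : k * y ≤ k := by nlinarith
  -- The mean number of receptions exceeds `k` by about `k y / 2`. Of this, `q` is kept for the
  -- union over `u`; the rest, at least `k y / 8` after rounding since `k y ≥ 8`, is the Hoeffding
  -- gap.
  set N : ℕ := ⌊(k + k * y / 2) / P⌋₊ with hN
  set q : ℕ := ⌈k * y / 8⌉₊ with hq
  have hNle : (N : ℝ) ≤ (k + k * y / 2) / P := Nat.floor_le (by positivity)
  have hNge : (k + k * y / 2) - P ≤ P * N := by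
    have h1 : (k + k * y / 2) / P < N + 1 := Nat.lt_floor_add_one _
    rw [div_lt_iff₀ hp] at h1
    nlinarith
  have hqge : k * y / 8 ≤ q := Nat.le_ceil _
  have hqle : (q : ℝ) < k * y / 8 + 1 := Nat.ceil_lt_add_one (by positivity)
  have hgap : k * y / 8 ≤ P * N - (k + q : ℕ) := by
    push_cast
    linarith
  have hm : ((k + q : ℕ) : ℝ) ≤ P * N := by linarith
  have hNpos : (0 : ℝ) < N := by
    have : 0 < P * N := by linarith
    exact pos_of_mul_pos_right this hp.le
  have hN2k : P * N ≤ 2 * k := by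
    rw [le_div_iff₀ hp] at hNle
    linarith
  obtain ⟨l, rfl⟩ : ∃ l, L = l + 1 := ⟨L - 1, by omega⟩
  set B : ℝ := 2 ^ (2 * (k * y ^ 3)) with hB
  have hBpos : 0 < B := Real.rpow_pos_of_pos two_pos _
  have hBZ : B = Z ^ (2 * (l + 1)) := by
    rw [hB, ← h, ← Real.rpow_natCast Z]
    conv_rhs => rw [← Real.rpow_logb two_pos (by norm_num) (show 0 < Z by linarith)]
    rw [← Real.rpow_mul two_pos.le]
    congr 1
    push_cast
    ring
  have hcount : ((N : ℝ) + 1) ^ l * 2 ≤ ε * B := by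
    rw [hBZ]
    exact pow_mul_two_le hp hp1 (by linarith) hε hε1 hN2k
  have hexp : Real.exp (-2 * (P * N - (k + q : ℕ)) ^ 2 / N) ≤ B⁻¹ :=
    exp_neg_sq_div_le (by positivity) hNpos hN2k hy hyp hgap
  have hpow : (2 : ℝ) ^ k * (2 ^ (k + q))⁻¹ ≤ B⁻¹ := by
    have : (2 : ℝ) ^ k * (2 ^ (k + q))⁻¹ = (2 ^ q)⁻¹ := by
      rw [pow_add]; field_simp
    rw [this]
    refine inv_anti₀ hBpos ?_
    rw [hB, ← Real.rpow_natCast 2 q]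
    refine Real.rpow_le_rpow_of_exponent_le one_le_two (le_trans ?_ hqge)
    have hy1 : y ≤ 1 / 256 := by linarith
    have hy2 : y ^ 2 ≤ 1 / 16 := by nlinarith
    have := mul_le_mul_of_nonneg_left hy2 (show 0 ≤ k * y by linarith)
    linarith
  have hle : epsCodingDelay p (l + 1) k ε ≤ N := by
    unfold epsCodingDelay
    refine sInf_le ⟨N, rfl, (law_codingDelay_gt_le_ofReal p k l N (k + q) hm).trans
      (ENNReal.ofReal_le_ofReal ?_)⟩
    calc ((N : ℝ) + 1) ^ l * (Real.exp (-2 * (P * N - (k + q : ℕ)) ^ 2 / N) +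
          2 ^ k * (2 ^ (k + q))⁻¹) ≤ ((N : ℝ) + 1) ^ l * (B⁻¹ + B⁻¹) := by gcongr
      _ = ((N : ℝ) + 1) ^ l * 2 * B⁻¹ := by ring
      _ ≤ ε * B * B⁻¹ := by gcongr
      _ = ε := by field_simp
  obtain ⟨n, hn⟩ := ENat.ne_top_iff_exists.1 (ne_top_of_le_ne_top (ENat.natCast_ne_top N) hle)
  refine ⟨n, hn.symm, ?_⟩
  rw [← hn] at hle
  have : (n : ℝ) ≤ N := by exact_mod_cast hle
  rw [one_div, inv_mul_eq_div]
  exact this.trans hNle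

/-- The hypothesis says `y ^ 3 → 0`, so `y` eventually drops below any fixed multiple of `p`. -/
lemma eventually_exists_scale {p : unitInterval} {L : ℕ → ℕ} {ε : ℕ → ℝ} (hp : 0 < (p : ℝ))
    (hL : ∀ k, 1 ≤ L k) (hε : ∀ k, 0 < ε k ∧ ε k < 1)
    (ho : (fun k : ℕ => (L k : ℝ) * Real.logb 2 (k * L k / (p * ε k))) =o[atTop]
      fun k : ℕ => (k : ℝ)) :
    ∀ᶠ k : ℕ in atTop, 64 ≤ k ∧ ∃ y : ℝ, 0 < y ∧ y ≤ p / 256 ∧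
      L k * Real.logb 2 (k * L k / (p * ε k)) = k * y ^ 3 := by
  filter_upwards [eventually_ge_atTop 64,
    ho.def (show (0 : ℝ) < ((p : ℝ) / 256) ^ 3 by positivity)] with k hk h
  have hlog := (one_le_logb hp p.2.2 (hε k).1 (hε k).2 hk (hL k)).2
  set X := (L k : ℝ) * Real.logb 2 (k * L k / (p * ε k)) with hX
  have hL' : (1 : ℝ) ≤ L k := by exact_mod_cast hL k
  have hk' : (0 : ℝ) < k := by exact_mod_cast (by omega : 0 < k)
  have hXpos : 0 < X := by positivity
  have hcube : ((X / k) ^ (1 / 3 : ℝ)) ^ 3 = X / k := by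
    rw [← Real.rpow_natCast, ← Real.rpow_mul (by positivity)]
    norm_num
  refine ⟨hk, (X / k) ^ (1 / 3 : ℝ), by positivity, ?_, ?_⟩
  · refine le_of_pow_le_pow_left₀ (n := 3) (by norm_num) (by positivity) ?_
    rw [hcube, div_le_iff₀ hk']
    simpa [abs_of_pos hXpos] using h
  · rw [hcube]
    field_simp

lemma rpow_third_of_cube {x : ℝ} (hx : 0 ≤ x) : (x ^ 3) ^ (1 / 3 : ℝ) = x := by
  rw [← Real.rpow_natCast, ← Real.rpow_mul hx]
  norm_num

lemma logb_div_le {p ε a : ℝ} {k L : ℕ} (hp : 0 < p) (hε : 0 < ε) (hk : 1 ≤ k)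
    (hkp : 1 / p ≤ k) (hL : 1 ≤ L) (ha : 0 ≤ a) (hεa : (k : ℝ) ^ (-a) ≤ ε) :
    Real.logb 2 (k * L / (p * ε)) ≤ (2 + a) * Real.logb 2 (k * L) := by
  have hk' : (1 : ℝ) ≤ k := by exact_mod_cast hk
  have hL' : (1 : ℝ) ≤ L := by exact_mod_cast hL
  have hkL : (k : ℝ) ≤ k * L := by nlinarith
  rw [← Real.logb_rpow_eq_mul_logb_of_pos (by positivity)]
  refine Real.logb_le_logb_of_le one_lt_two (by positivity) ?_
  have h1 : 1 / ε ≤ ((k : ℝ) * L) ^ a := by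
    calc 1 / ε ≤ 1 / (k : ℝ) ^ (-a) := one_div_le_one_div_of_le (by positivity) hεa
      _ = (k : ℝ) ^ a := by rw [Real.rpow_neg (by positivity)]; simp
      _ ≤ _ := Real.rpow_le_rpow (by positivity) hkL ha
  calc (k : ℝ) * L / (p * ε) = k * L * (1 / p) * (1 / ε) := by field_simp
    _ ≤ k * L * (k * L) * ((k : ℝ) * L) ^ a := by
        have := hkp.trans hkL
        gcongr
    _ = ((k : ℝ) * L) ^ (2 + a) := by
        rw [Real.rpow_add (by positivity), Real.rpow_two]
        ring

end LineNetwork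

/-! ### Comparison with the stated bounds -/

theorem mainTheorem2 :
    (∀ (p : unitInterval) (L : ℕ → ℕ) (ε w : ℕ → ℝ), 0 < (p : ℝ) →
      (∀ k, 1 ≤ L k) → (∀ k, 0 < ε k ∧ ε k < 1) →
      ((fun k : ℕ => (L k : ℝ) * Real.logb 2 (k * L k / (p * ε k))) =o[atTop]
        fun k : ℕ => (k : ℝ)) →
      (w ~[atTop] fun k : ℕ =>
        ((k : ℝ) * (L k : ℝ) ^ 2 / Real.logb 2 (k * L k / (p * ε k))) ^ (1 / 3 : ℝ)) →
      ∃ δ : ℕ → ℝ, Tendsto δ atTop (𝓝 0) ∧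
        ∀ᶠ k : ℕ in atTop, ∃ N : ℕ,
          LineNetwork.epsCodingDelay p (L k) k (ε k) = N ∧
          (N : ℝ) ≤ 1 / (p : ℝ) * (k + (1 + δ k) *
            (k * L k / w k + Real.sqrt (k * (w k * Real.logb 2 (w k * L k / ε k)))
              + w k * Real.logb 2 (w k * L k / ε k)))) ∧
    (∀ a : ℝ, 0 < a → ∃ C : ℝ,
      ∀ (p : unitInterval) (L : ℕ → ℕ) (ε : ℕ → ℝ), 0 < (p : ℝ) →
      (∀ k, 1 ≤ L k) → (∀ k, 0 < ε k ∧ ε k < 1) →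
      ((fun k : ℕ => (L k : ℝ) * Real.logb 2 (k * L k)) =o[atTop] fun k : ℕ => (k : ℝ)) →
      (∀ᶠ k : ℕ in atTop, (k : ℝ) ^ (-a) ≤ ε k) →
      ∀ᶠ k : ℕ in atTop, ∃ N : ℕ,
        LineNetwork.epsCodingDelay p (L k) k (ε k) = N ∧
        (N : ℝ) ≤ 1 / (p : ℝ) *
          (k + C * ((k : ℝ) ^ 2 * L k * Real.logb 2 (k * L k)) ^ (1 / 3 : ℝ))) := by
  -- The `o(1)` term can be zero: `k L / w ~ k y`, twice the excess `k y / 2` obtained, and the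
  -- other two summands need only be nonnegative.
  refine ⟨fun p L ε w hp hL hε ho hw => ⟨fun _ => 0, tendsto_const_nhds, ?_⟩,
    fun a ha => ⟨(2 + a) ^ (1 / 3 : ℝ), fun p L ε hp hL hε ho hεa => ?_⟩⟩
  · filter_upwards [LineNetwork.eventually_exists_scale hp hL hε ho,
      hw.def (show (0 : ℝ) < 1 / 2 by norm_num)] with k ⟨hk, y, hy, hyp, h⟩ hwk
    obtain ⟨N, hN, hNle⟩ := LineNetwork.epsCodingDelay_le hp hk (hL k) (hε k).1 (hε k).2
      hy.le hyp h
    refine ⟨N, hN, hNle.trans ?_⟩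
    have hk' : (0 : ℝ) < k := by exact_mod_cast (by omega : 0 < k)
    have hL' : (1 : ℝ) ≤ L k := by exact_mod_cast hL k
    have hlog := (LineNetwork.one_le_logb hp p.2.2 (hε k).1 (hε k).2 hk (hL k)).2
    have hw0 : ((k : ℝ) * (L k : ℝ) ^ 2 / Real.logb 2 (k * L k / (p * ε k))) ^ (1 / 3 : ℝ) =
        L k / y := by
      rw [← LineNetwork.rpow_third_of_cube (show 0 ≤ L k / y by positivity)]
      congr 1
      rw [div_pow, div_eq_div_iff (by positivity) (by positivity)]
      linear_combination -(L k : ℝ) ^ 2 * h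
    simp only [Pi.sub_apply, hw0] at hwk
    rw [Real.norm_eq_abs, Real.norm_of_nonneg (by positivity), abs_le] at hwk
    have hLy : 2 ≤ L k / y := by
      rw [le_div_iff₀ hy]
      linarith [p.2.2]
    have hw1 : 1 ≤ w k := by linarith
    have hmain : k * y / 2 ≤ k * L k / w k := by
      have hwy : w k ≤ 2 * (L k / y) := by linarith
      have : w k * y ≤ 2 * L k := by
        calc w k * y ≤ 2 * (L k / y) * y := by gcongr
          _ = 2 * L k := by field_simp
      rw [div_le_div_iff₀ two_pos (by linarith)]
      nlinarith
    have hlogw : 0 ≤ Real.logb 2 (w k * L k / ε k) := by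
      refine Real.logb_nonneg one_lt_two ?_
      rw [le_div_iff₀ (hε k).1]
      nlinarith [(hε k).2]
    have hthird : 0 ≤ w k * Real.logb 2 (w k * L k / ε k) := by positivity
    have := Real.sqrt_nonneg (k * (w k * Real.logb 2 (w k * L k / ε k)))
    gcongr
    linarith
  -- Once `k ≥ 1 / p`, the factors `1 / p` and `1 / ε` cost at most the powers `1` and `a` of `k L`.
  -- The logarithm grows by a factor `2 + a`, whose cube root is `C`.
  · have hcmp : ∀ᶠ k : ℕ in atTop, 64 ≤ k ∧ Real.logb 2 (k * L k / (p * ε k)) ≤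
        (2 + a) * Real.logb 2 (k * L k) := by
      filter_upwards [eventually_ge_atTop 64, eventually_ge_atTop ⌈1 / (p : ℝ)⌉₊, hεa]
        with k hk hkp hεk
      exact ⟨hk, LineNetwork.logb_div_le hp (hε k).1 (by omega) (Nat.ceil_le.1 hkp) (hL k) ha.le
        hεk⟩
    have ho' : (fun k : ℕ => (L k : ℝ) * Real.logb 2 (k * L k / (p * ε k))) =o[atTop]
        fun k : ℕ => (k : ℝ) := by
      refine IsBigO.trans_isLittleO (IsBigO.of_bound (2 + a) ?_) ho
      filter_upwards [hcmp] with k ⟨hk, hle⟩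
      have hlog := (LineNetwork.one_le_logb hp p.2.2 (hε k).1 (hε k).2 hk (hL k)).2
      rw [Real.norm_of_nonneg (by positivity), Real.norm_eq_abs]
      refine le_trans ?_ (mul_le_mul_of_nonneg_left (le_abs_self _) (by linarith))
      calc _ ≤ (L k : ℝ) * ((2 + a) * Real.logb 2 (k * L k)) := by gcongr
        _ = _ := by ring
    filter_upwards [LineNetwork.eventually_exists_scale hp hL hε ho', hcmp]
      with k ⟨hk, y, hy, hyp, h⟩ ⟨_, hle⟩
    obtain ⟨N, hN, hNle⟩ := LineNetwork.epsCodingDelay_le hp hk (hL k) (hε k).1 (hε k).2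
      hy.le hyp h
    refine ⟨N, hN, hNle.trans ?_⟩
    have hlog := (LineNetwork.one_le_logb hp p.2.2 (hε k).1 (hε k).2 hk (hL k)).2
    have hlog' : 0 ≤ Real.logb 2 (k * L k) := by nlinarith
    have hT : k * y ≤ (2 + a) ^ (1 / 3 : ℝ) *
        ((k : ℝ) ^ 2 * L k * Real.logb 2 (k * L k)) ^ (1 / 3 : ℝ) := by
      rw [← Real.mul_rpow (by positivity) (by positivity),
        ← LineNetwork.rpow_third_of_cube (show 0 ≤ k * y by positivity)]
      refine Real.rpow_le_rpow (by positivity) ?_ (by norm_num)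
      calc (k * y) ^ 3 = k ^ 2 * (L k * Real.logb 2 (k * L k / (p * ε k))) := by rw [h]; ring
        _ ≤ k ^ 2 * (L k * ((2 + a) * Real.logb 2 (k * L k))) := by gcongr
        _ = _ := by ring
    have hky : 0 ≤ k * y := by positivity
    gcongr
    linarith
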